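/- Write $c_0$ for the Banach space of real null sequences with the supremum norm. A sequence $(e_n)_n$ in a real seminormed space is *spreading* if $\|\sum_{j=1}^n a_je_j\|=\|\sum_{j=1}^n a_je_{k_j}\|$ for all $n$, all $k_1<\dots<k_n$ and all real $a_1,\dots,a_n$; it is *trivial* if moreover $\|\sum_{j=1}^n a_je_j\|=0$ for some $n$ and some $a_1,\dots,a_n$ not all zero. Sequences $(x_n)_n$, $(y_n)_n$ in seminormed spaces are *equivalent* if there are $0<c\le C$ with $c\|\sum_{i=1}^n a_ix_i\|\le\|\sum_{i=1}^n a_iy_i\|\le C\|\sum_{i=1}^n a_ix_i\|$ for all $n$ and all real $a_1,\dots,a_n$. For $M\subseteq\mathbb N$, let $[M]^2$ be the set of pairs $s=\{s(1)<s(2)\}\subseteq M$. A finite sequence $(s_j)_{j=1}^m$ in $[M]^2$ is a *plegma family* if $s_1(1)<\dots<s_m(1)<s_1(2)<\dots<s_m(2)$. A linearly independent sequence $(u_n)_n$ in a seminormed space (that is, a Hamel basis of its linear span) is a *2-spreading model of $c_0$* if there are a family $(x_s)_{s\in[\mathbb N]^2}$ in $c_0$, an infinite set $M=\{M(1)<M(2)<\cdots\}\subseteq\mathbb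 N$ and positive reals $\delta_l\to0$ such that $$\Big|\,\big\|\sum_{j=1}^m a_jx_{s_j}\big\|-\big\|\sum_{j=1}^m a_ju_j\big\|\,\Big|\le\delta_l$$ for all $1\le m\le l$, all plegma families $(s_j)_{j=1}^m$ in $[M]^2$ with $s_1(1)\ge M(l)$ and all $a_1,\dots,a_m\in[-1,1]$. A sequence in a Banach space is *Schauder basic* if it is a Schauder basis of its closed linear span; it is *bimonotone* if all projections of that span onto intervals of basis vectors have norm at most $1$. A spreading sequence in a Banach space is *singular* if it is neither trivial nor Schauder basic. **Theorem.** 1. Every spreading sequence in a real seminormed space is equivalent to some 2-spreading model of $c_0$. 2. Every bimonotone Schauder basic spreading sequence in a real Banach space is itself a 2-spreading model of $c_0$. 3. If $(e_n)_n$ is a singular spreading sequence in a real Banach space, then $(e_n)_n$ converges weakly to some $e\neq0$ and, with $e'_n=e_n-e$, there is a 2-spreading model $(u_n)_n$ of $c_0$ which is equivalent to $(e_n)_n$ and satisfies $$\Big\|\sum_{j=1}^n a_ju_j\Big\|=\max\Big\{\Big|\sum_{j=1}^n a_j\Big|\,\|e\|,\ \Big\|\sum_{j=1}^n a_je'_j\Big\|\Big\}$$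 for all $n$ and all real $a_1,\dots,a_n$. -/

import Mathlib

open Filter Topology
open scoped ZeroAtInfty

/-- The Banach space `c₀` of real null sequences with the supremum norm. -/
abbrev CZero : Type := C₀(ℕ, ℝ)

section Spreading

variable {E : Type*} [SeminormedAddCommGroup E] [NormedSpace ℝ E]

/-- A sequence in a seminormed space is spreading if it is isometric to each of its
subsequences. -/
def IsSpreading (e : ℕ → E) : Prop :=
  ∀ (n : ℕ) (a : Fin n → ℝ) (k : Fin n → ℕ), StrictMono k →
    ‖∑ j, a j • e j‖ = ‖∑ j, a j • e (k j)‖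

/-- A spreading sequence is trivial if some linear combination of its terms with coefficients
not all zero has seminorm zero. -/
def IsTrivialSpreading (e : ℕ → E) : Prop :=
  IsSpreading e ∧ ∃ (n : ℕ) (a : Fin n → ℝ), a ≠ 0 ∧ ‖∑ j, a j • e j‖ = 0

/-- Equivalence of two sequences lying in possibly different seminormed spaces. -/
def SeqEquivalent {F : Type*} [SeminormedAddCommGroup F] [NormedSpace ℝ F]
    (x : ℕ → E) (y : ℕ → F) : Prop :=
  ∃ c C : ℝ, 0 < c ∧ c ≤ C ∧ ∀ (n : ℕ) (a : Fin n → ℝ),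
    c * ‖∑ i, a i • x i‖ ≤ ‖∑ i, a i • y i‖ ∧
      ‖∑ i, a i • y i‖ ≤ C * ‖∑ i, a i • x i‖

end Spreading

section SpreadingModels

/-- The `k`-element subsets of `ℕ`, each identified with its increasing enumeration. -/
abbrev KSubset (k : ℕ) : Type := Fin k ↪o ℕ

/-- A finite sequence `s 0, …, s m` of `k`-subsets of `ℕ` is a plegma family if
`s 0 i < … < s m i` for every `i`, and `s m i < s 0 (i + 1)` whenever `i + 1 < k`. -/
def IsPlegma {k m : ℕ} (s : Fin (m + 1) → KSubset k) : Prop :=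
  (∀ i : Fin k, StrictMono fun j => s j i) ∧
    ∀ (i : ℕ) (hi : i + 1 < k),
      s (Fin.last m) ⟨i, Nat.lt_of_succ_lt hi⟩ < s 0 ⟨i + 1, hi⟩

variable {X : Type*} [NormedAddCommGroup X] [NormedSpace ℝ X]
variable {E : Type*} [SeminormedAddCommGroup E] [NormedSpace ℝ E]

/-- The restriction of the `k`-sequence `x` to the `k`-subsets of the infinite set
`M 0 < M 1 < …` generates `e` as a `k`-spreading model, where `e` is a Hamel basis of its linear
span. Families have `m + 1` members and the tolerances are numbered from `0`, so `m ≤ l` says that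
the number of members is at most the position, counted from one, of `δ l`. -/
def GeneratesSpreadingModel {k : ℕ} [NeZero k] (x : KSubset k → X) (M : ℕ → ℕ) (e : ℕ → E) :
    Prop :=
  LinearIndependent ℝ e ∧
    ∃ δ : ℕ → ℝ, (∀ l, 0 < δ l) ∧ Tendsto δ atTop (𝓝 0) ∧
      ∀ (m l : ℕ), m ≤ l → ∀ s : Fin (m + 1) → KSubset k,
        (∀ j i, s j i ∈ Set.range M) → IsPlegma s → M l ≤ s 0 0 →
        ∀ a : Fin (m + 1) → ℝ, (∀ j, a j ∈ Set.Icc (-1 : ℝ) 1) →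
          |‖∑ j, a j • x (s j)‖ - ‖∑ j, a j • e j‖| ≤ δ l

variable (X) in
/-- `e` is a `k`-spreading model of the space `X`. -/
def IsSpreadingModel (k : ℕ) [NeZero k] (e : ℕ → E) : Prop :=
  ∃ (x : KSubset k → X) (M : ℕ → ℕ), StrictMono M ∧ GeneratesSpreadingModel x M e

end SpreadingModels

section Schauder

variable {E : Type*} [NormedAddCommGroup E] [NormedSpace ℝ E]

/-- The closed linear span of a sequence. -/
abbrev closedSpan (e : ℕ → E) : Submodule ℝ E :=
  (Submodule.span ℝ (Set.range e)).topologicalClosure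

/-- A sequence in a Banach space is Schauder basic if it is a Schauder basis of its closed linear
span. -/
def IsSchauderBasic (e : ℕ → E) : Prop :=
  ∃ b : SchauderBasis ℝ (closedSpan e), ∀ n, (b n : E) = e n

/-- A Schauder basic sequence is bimonotone if all projections of its closed linear span onto
intervals of basis vectors have norm at most one. -/
def IsBimonotoneSchauderBasic (e : ℕ → E) : Prop :=
  ∃ b : SchauderBasis ℝ (closedSpan e), (∀ n, (b n : E) = e n) ∧
    ∀ m n : ℕ, ‖GeneralSchauderBasis.proj b (Finset.Ico m n)‖ ≤ 1

/-- A spreading sequence is singular if it is neither trivial nor Schauder basic. -/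
def IsSingularSpreading (e : ℕ → E) : Prop :=
  IsSpreading e ∧ ¬ IsTrivialSpreading e ∧ ¬ IsSchauderBasic e

/-- Weak convergence of a sequence. -/
def WeaklyConverges (e : ℕ → E) (v : E) : Prop :=
  ∀ f : StrongDual ℝ E, Tendsto (fun n => f (e n)) atTop (𝓝 (f v))

end Schauder

/-! The core is a construction in `c₀`, carried by `isSpreadingModel_of_norm_eq_max`. Let `g` be
spreading, with passage to intervals of indices not increasing norms. For each level `n`, finitely
many functionals `f n i` of norm at most one norm the combinations of `g 0, …, g n` with
coefficients in `[-1, 1]` up to `1 / (n + 1)`. The vector attached to a pair `s` has at coordinate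
`(n, i)` the value `f n i (g (s 0))` if `s 0 ≤ n < s 1`, and `0` otherwise. In a plegma family the
members active at a given level form an initial or a final segment, so no coordinate exceeds the
norm of the full combination. At the level of the largest first element all members are active, and
the norm is recovered up to the tolerance. One extra coordinate records the sum of the coefficients.

It remains to reach such a `g`. If the basis constants of `e` are bounded, the supremum of the norms
of interval sums is an equivalent spreading norm. If not, some head of a combination is almost
cancelled by its tail. Spreading and averaging turn the tail into a multiple of an arbitrary long
mean, so all long means are close to one vector and converge uniformly to some `v ≠ 0`
(`IsSpreading.exists_uniformMeanLimit`). Then `e n → v` weakly, and `e n - v` is spreading with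
means tending to zero, hence suppression unconditional. The bound `|∑ a j| * ‖v‖ ≤ ‖∑ a j • e j‖`
makes the maximum norm equivalent to the original one. -/

/-! ### Spreading sequences and uniform limits of means -/

section SpreadingSequences

variable {E : Type*} [SeminormedAddCommGroup E] [NormedSpace ℝ E]

/-- A coefficient vector is the restriction of a coefficient sequence. -/
lemma exists_nat_extension {n : ℕ} (a : Fin n → ℝ) : ∃ b : ℕ → ℝ, a = fun j : Fin n => b j :=
  ⟨fun i => if h : i < n then a ⟨i, h⟩ else 0, by ext j; simp⟩

/-- To verify spreading, coefficient sequences and increasing maps of `ℕ` suffice. -/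
lemma isSpreading_of_range {e : ℕ → E}
    (h : ∀ (n : ℕ) (a : ℕ → ℝ) (k : ℕ → ℕ), StrictMono k →
      ‖∑ j ∈ Finset.range n, a j • e j‖ = ‖∑ j ∈ Finset.range n, a j • e (k j)‖) :
    IsSpreading e := by
  intro n a k hk
  obtain ⟨b, rfl⟩ := exists_nat_extension a
  let R := ∑ i, k i
  have hR : ∀ i, k i ≤ R := fun i => Finset.single_le_sum (f := k) (by simp) (Finset.mem_univ i)
  let k' : ℕ → ℕ := fun j => if h : j < n then k ⟨j, h⟩ else R + 1 + j
  have hk' : StrictMono k' := by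
    intro i j hij
    simp only [k']
    split_ifs with h1 h2 h2
    · exact hk (by simpa using hij)
    · have := hR ⟨i, h1⟩
      omega
    · omega
    · omega
  have := h n b k' hk'
  rw [← Fin.sum_univ_eq_sum_range (fun j => b j • e j),
    ← Fin.sum_univ_eq_sum_range (fun j => b j • e (k' j))] at this
  simpa [k'] using this

/-- A linear combination of a spreading sequence indexed by a finite subset of a linear order has
a norm that does not depend on the increasing position of its terms. -/
lemma IsSpreading.norm_sum_eq {e : ℕ → E} (he : IsSpreading e) {ι : Type*} [LinearOrder ι]
    (s : Finset ι) (a : ι → ℝ) {f g : ι → ℕ} (hf : StrictMonoOn f s) (hg : StrictMonoOn g s) :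
    ‖∑ i ∈ s, a i • e (f i)‖ = ‖∑ i ∈ s, a i • e (g i)‖ := by
  have key : ∀ f : ι → ℕ, StrictMonoOn f s →
      ‖∑ i ∈ s, a i • e (f i)‖ = ‖∑ j : Fin s.card, a (s.orderEmbOfFin rfl j) • e j‖ := by
    intro f hf
    rw [he s.card (fun j => a (s.orderEmbOfFin rfl j)) (fun j => f (s.orderEmbOfFin rfl j))
      (fun i j hij => hf (s.orderEmbOfFin_mem rfl i) (s.orderEmbOfFin_mem rfl j)
        ((s.orderEmbOfFin rfl).strictMono hij))]
    rw [← Finset.sum_coe_sort s, ← (s.orderIsoOfFin rfl).toEquiv.sum_comp]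
    rfl
  rw [key f hf, key g hg]

lemma IsSpreading.norm_sum_comp {e : ℕ → E} (he : IsSpreading e) (s : Finset ℕ) (a : ℕ → ℝ)
    {k : ℕ → ℕ} (hk : StrictMono k) :
    ‖∑ j ∈ s, a j • e (k j)‖ = ‖∑ j ∈ s, a j • e j‖ :=
  he.norm_sum_eq s a (hk.strictMonoOn _) (strictMono_id.strictMonoOn _)

lemma IsSpreading.norm_eq {e : ℕ → E} (he : IsSpreading e) (i j : ℕ) : ‖e i‖ = ‖e j‖ := by
  simpa using he.norm_sum_eq {0} (fun _ => 1) (f := fun _ => i) (g := fun _ => j)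
    (by simp) (by simp)

/-- The arithmetic mean of the first `N` terms of the subsequence of `e` along `κ`. -/
noncomputable def subseqMean (e : ℕ → E) (κ : ℕ → ℕ) (N : ℕ) : E :=
  (N : ℝ)⁻¹ • ∑ t ∈ Finset.range N, e (κ t)

/-- The means of the subsequences of `e` converge to `v`, uniformly over all subsequences. -/
def UniformMeanLimit (e : ℕ → E) (v : E) : Prop :=
  ∀ η : ℝ, 0 < η → ∀ᶠ N in atTop, ∀ κ : ℕ → ℕ, StrictMono κ → ‖subseqMean e κ N - v‖ ≤ η

lemma subseqMean_sub (e : ℕ → E) (v : E) (κ : ℕ → ℕ) {N : ℕ} (hN : 0 < N) :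
    subseqMean (fun n => e n - v) κ N = subseqMean e κ N - v := by
  have : (N : ℝ) ≠ 0 := by positivity
  simp [subseqMean, Finset.sum_sub_distrib, smul_sub, ← Nat.cast_smul_eq_nsmul ℝ, smul_smul, this]

lemma UniformMeanLimit.sub {e : ℕ → E} {v : E} (h : UniformMeanLimit e v) :
    UniformMeanLimit (fun n => e n - v) 0 := by
  intro η hη
  filter_upwards [h η hη, eventually_gt_atTop 0] with N hN h0 κ hκ
  rw [subseqMean_sub _ _ _ h0, sub_zero]
  exact hN κ hκ

lemma IsSpreading.norm_subseqMean_le {e : ℕ → E} (he : IsSpreading e) (κ : ℕ → ℕ) (N : ℕ) :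
    ‖subseqMean e κ N‖ ≤ ‖e 0‖ := by
  rcases Nat.eq_zero_or_pos N with rfl | hN
  · simp [subseqMean]
  have h1 : ‖∑ t ∈ Finset.range N, e (κ t)‖ ≤ N * ‖e 0‖ := by
    refine (norm_sum_le _ _).trans ?_
    rw [Finset.sum_congr rfl fun t _ => he.norm_eq (κ t) 0]
    simp
  rw [subseqMean, norm_smul, norm_inv, Real.norm_natCast]
  have : (0 : ℝ) < N := by positivity
  rw [inv_mul_le_iff₀ this]
  exact h1

/-- Replacing some of the terms of a linear combination of a spreading sequence by means over
blocks does not increase its norm. -/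
lemma IsSpreading.norm_sum_block_le {e : ℕ → E} (he : IsSpreading e) {N : ℕ} (hN : 0 < N) (n : ℕ)
    (a : ℕ → ℝ) (p : ℕ → Prop) [DecidablePred p] :
    ‖∑ j ∈ Finset.range n,
        a j • (if p j then subseqMean e (fun t => j * N + t) N else e (j * N))‖ ≤
      ‖∑ j ∈ Finset.range n, a j • e j‖ := by
  have hN' : (0 : ℝ) < N := by positivity
  have h1 : ∑ j ∈ Finset.range n,
        a j • (if p j then subseqMean e (fun t => j * N + t) N else e (j * N)) =
      (N : ℝ)⁻¹ • ∑ t ∈ Finset.range N, ∑ j ∈ Finset.range n,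
        a j • e (if p j then j * N + t else j * N) := by
    rw [Finset.sum_comm, Finset.smul_sum]
    refine Finset.sum_congr rfl fun j _ => ?_
    split_ifs
    · rw [subseqMean, smul_comm, Finset.smul_sum]
    · simp [← Nat.cast_smul_eq_nsmul ℝ, smul_smul, hN'.ne']
  rw [h1, norm_smul, norm_inv, Real.norm_natCast, inv_mul_le_iff₀ hN']
  refine (norm_sum_le _ _).trans ?_
  -- For fixed `t < N` the `j`-th index stays inside the `j`-th block of length `N`, so the indices
  -- increase.
  have h2 : ∀ t ∈ Finset.range N,
      ‖∑ j ∈ Finset.range n, a j • e (if p j then j * N + t else j * N)‖ =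
        ‖∑ j ∈ Finset.range n, a j • e j‖ := by
    intro t ht
    refine he.norm_sum_comp _ _ ?_
    intro i j hij
    have ht' := Finset.mem_range.1 ht
    have : (i + 1) * N ≤ j * N := Nat.mul_le_mul_right _ hij
    have h3 : (i + 1) * N = i * N + N := by ring
    dsimp only
    split_ifs <;> omega
  rw [Finset.sum_congr rfl h2]
  simp

/-- Replacing some of the terms of a linear combination of a spreading sequence by the uniform
limit of means does not increase its norm. -/
lemma IsSpreading.exists_norm_sum_limit_le {e : ℕ → E} (he : IsSpreading e) {v : E}
    (hv : UniformMeanLimit e v) (n : ℕ) (a : ℕ → ℝ) (p : ℕ → Prop) [DecidablePred p] {η : ℝ}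
    (hη : 0 < η) :
    ∃ N : ℕ, 0 < N ∧ ‖∑ j ∈ Finset.range n, a j • (if p j then v else e (j * N))‖ ≤
      ‖∑ j ∈ Finset.range n, a j • e j‖ + η := by
  set K := ∑ j ∈ Finset.range n, |a j| with hK
  have hK0 : 0 ≤ K := Finset.sum_nonneg fun _ _ => abs_nonneg _
  obtain ⟨N, hN, hN0⟩ := ((hv (η / (K + 1)) (by positivity)).and (eventually_gt_atTop 0)).exists
  refine ⟨N, hN0, ?_⟩
  have hb := he.norm_sum_block_le hN0 n a p
  have hd : ‖∑ j ∈ Finset.range n, a j • (if p j then v else e (j * N)) -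
      ∑ j ∈ Finset.range n,
        a j • (if p j then subseqMean e (fun t => j * N + t) N else e (j * N))‖ ≤ η := by
    rw [← Finset.sum_sub_distrib]
    calc _ ≤ ∑ j ∈ Finset.range n, |a j| * (η / (K + 1)) := by
          refine (norm_sum_le _ _).trans (Finset.sum_le_sum fun j _ => ?_)
          rw [← smul_sub, norm_smul, Real.norm_eq_abs]
          refine mul_le_mul_of_nonneg_left ?_ (abs_nonneg _)
          split_ifs
          · rw [norm_sub_rev]
            exact hN _ fun s t hst => by simpa using hst
          · simp; positivity
      _ = K * (η / (K + 1)) := by rw [← Finset.sum_mul]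
      _ ≤ η := by
          rw [mul_div_assoc', div_le_iff₀ (by positivity)]
          nlinarith
  linarith [(norm_sub_norm_le _ _).trans hd]

/-- Every term is replaced by the limit of means. -/
lemma IsSpreading.abs_sum_mul_norm_le {e : ℕ → E} (he : IsSpreading e) {v : E}
    (hv : UniformMeanLimit e v) (n : ℕ) (a : ℕ → ℝ) :
    |∑ j ∈ Finset.range n, a j| * ‖v‖ ≤ ‖∑ j ∈ Finset.range n, a j • e j‖ := by
  refine le_of_forall_pos_le_add fun η hη => ?_
  obtain ⟨N, -, h⟩ := he.exists_norm_sum_limit_le hv n a (fun _ => True) hη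
  simpa [← Finset.sum_smul, norm_smul] using h

/-- A spreading sequence whose means tend to zero is suppression unconditional with
constant one. -/
lemma IsSpreading.norm_sum_filter_le {e : ℕ → E} (he : IsSpreading e)
    (hv : UniformMeanLimit e 0) (n : ℕ) (a : ℕ → ℝ) (p : ℕ → Prop) [DecidablePred p] :
    ‖∑ j ∈ Finset.range n with p j, a j • e j‖ ≤ ‖∑ j ∈ Finset.range n, a j • e j‖ := by
  refine le_of_forall_pos_le_add fun η hη => ?_
  obtain ⟨N, hN, h⟩ := he.exists_norm_sum_limit_le hv n a (fun j => ¬ p j) hη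
  rw [← he.norm_sum_comp (k := fun j => j * N) _ _ fun i j hij => Nat.mul_lt_mul_of_pos_right hij hN]
  rw [Finset.sum_filter]
  refine (congrArg norm (Finset.sum_congr rfl fun j _ => ?_)).trans_le h
  by_cases hp : p j <;> simp [hp]

/-- The vector `v` is approximated by a mean taken to the right of all indices in use. The
difference then becomes a combination of `e` itself, whose coefficients do not depend on the
subsequence. -/
lemma IsSpreading.sub_uniformMeanLimit {e : ℕ → E} (he : IsSpreading e) {v : E}
    (hv : UniformMeanLimit e v) : IsSpreading fun n => e n - v := by
  apply isSpreading_of_range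
  intro n a k hk
  set σ := ∑ j ∈ Finset.range n, a j with hσ
  have hR : ∀ N, ∃ R, ∀ f : ℕ → ℕ, f = id ∨ f = k →
      ‖∑ j ∈ Finset.range n, a j • e (f j) - σ • subseqMean e (fun t => R + t) N‖ =
      ‖∑ j ∈ Finset.range (n + N), (if j < n then a j else - σ * (N : ℝ)⁻¹) • e j‖ := by
    intro N
    have hle := hk.id_le n
    -- Since `n ≤ k n`, this start lies beyond the first `n` indices of both `id` and `k`.
    refine ⟨k n + 1, fun f hf => ?_⟩
    have hf' : StrictMono f := by
      rcases hf with rfl | rfl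
      exacts [strictMono_id, hk]
    have hfn : ∀ i, i < n → f i < k n := by
      rcases hf with rfl | rfl
      · intro i hi; exact lt_of_lt_of_le hi hle
      · intro i hi; exact hk hi
    rw [← he.norm_sum_comp (k := fun j => if j < n then f j else k n + 1 + (j - n))]
    · rw [Finset.sum_range_add]
      congr 1
      rw [subseqMean, sub_eq_add_neg]
      congr 1
      · refine Finset.sum_congr rfl fun j hj => ?_
        simp [Finset.mem_range.1 hj]
      · simp [smul_smul, Finset.smul_sum]
    · intro i j hij
      dsimp only
      split_ifs with h1 h2 h2
      · exact hf' hij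
      · have := hfn i h1
        omega
      · omega
      · omega
  have hlim : ∀ f : ℕ → ℕ, ∀ η > 0, ∀ᶠ N in atTop, ∀ R : ℕ,
      |‖∑ j ∈ Finset.range n, a j • e (f j) - σ • subseqMean e (fun t => R + t) N‖ -
        ‖∑ j ∈ Finset.range n, a j • (e (f j) - v)‖| ≤ |σ| * η := by
    intro f η hη
    filter_upwards [hv η hη] with N hN R
    refine (abs_norm_sub_norm_le _ _).trans ?_
    have : ∑ j ∈ Finset.range n, a j • e (f j) - σ • subseqMean e (fun t => R + t) N -
        ∑ j ∈ Finset.range n, a j • (e (f j) - v) =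
        - (σ • (subseqMean e (fun t => R + t) N - v)) := by
      simp only [smul_sub, Finset.sum_sub_distrib, ← Finset.sum_smul, ← hσ]
      abel
    rw [this, norm_neg, norm_smul, Real.norm_eq_abs]
    exact mul_le_mul_of_nonneg_left (hN _ fun s t hst => by simpa using hst) (abs_nonneg _)
  refine eq_of_forall_dist_le fun ε hε => ?_
  rw [Real.dist_eq]
  have hη : 0 < ε / (2 * (|σ| + 1)) := by positivity
  obtain ⟨N, h1, h2⟩ := ((hlim id _ hη).and (hlim k _ hη)).exists
  obtain ⟨R, hR⟩ := hR N
  have h1 := h1 R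
  have h2 := h2 R
  rw [hR _ (Or.inl rfl)] at h1
  rw [hR _ (Or.inr rfl)] at h2
  have h3 : |σ| * (ε / (2 * (|σ| + 1))) ≤ ε / 2 := by
    rw [mul_div_assoc', div_le_div_iff₀ (by positivity) (by positivity)]
    nlinarith [abs_nonneg σ]
  simp only [id] at h1
  rw [abs_le] at h1 h2 ⊢
  constructor <;> linarith

/-- The initial segments of linear combinations of `e` are bounded by `C` times the whole
combinations. -/
def HasBasisConstant (e : ℕ → E) (C : ℝ) : Prop :=
  ∀ (n : ℕ) (a : ℕ → ℝ) (i : ℕ), i ≤ n →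
    ‖∑ j ∈ Finset.range i, a j • e j‖ ≤ C * ‖∑ j ∈ Finset.range n, a j • e j‖

end SpreadingSequences

/-! ### Unbounded basis constants: long means cluster -/

section UnboundedBasisConstant

/-- Each shift of the window by one exchanges one term for another, at cost at most `2 * B`. -/
lemma norm_sum_range_shift_sub_le {E : Type*} [SeminormedAddCommGroup E] {x : ℕ → E} {B : ℝ}
    (hx : ∀ n, ‖x n‖ ≤ B) (N j : ℕ) :
    ‖∑ t ∈ Finset.range N, x (t + j) - ∑ t ∈ Finset.range N, x t‖ ≤ 2 * j * B := by
  induction j with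
  | zero => simp
  | succ j ih =>
    have h : ∑ t ∈ Finset.range N, x (t + (j + 1)) - ∑ t ∈ Finset.range N, x (t + j) =
        x (N + j) - x j := by
      rw [← Finset.sum_sub_distrib]
      simpa [add_assoc, add_comm, add_left_comm] using
        Finset.sum_range_sub (fun t => x (t + j)) N
    have h2 : ‖x (N + j) - x j‖ ≤ B + B := norm_sub_le_of_le (hx _) (hx _)
    rw [← h] at h2
    have := norm_add_le_of_le h2 ih
    rw [sub_add_sub_cancel] at this
    push_cast
    linarith

variable {E : Type*} [SeminormedAddCommGroup E] [NormedSpace ℝ E]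

/-- The head stays fixed while the tail is moved to `κ (t + j)`, and the result is averaged over `t
< N`. Each tail coefficient then multiplies a mean shifted by `j`; undoing the shift costs at most
`2 * j * ‖e 0‖ / N`. -/
lemma IsSpreading.norm_add_subseqMean_le {e : ℕ → E} (he : IsSpreading e) {n i : ℕ} (hi : i ≤ n)
    (a : ℕ → ℝ) {κ : ℕ → ℕ} (hκ : StrictMono κ) {N : ℕ} (hN : 0 < N) :
    ‖∑ j ∈ Finset.range i, a j • e j + (∑ j ∈ Finset.Ico i n, a j) • subseqMean e κ N‖ ≤
      ‖∑ j ∈ Finset.range n, a j • e j‖ +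
        (∑ j ∈ Finset.Ico i n, |a j| * (2 * j * ‖e 0‖)) / N := by
  have hN' : (0 : ℝ) < N := by positivity
  have h1 : ‖∑ j ∈ Finset.range i, a j • e j +
      (N : ℝ)⁻¹ • ∑ t ∈ Finset.range N, ∑ j ∈ Finset.Ico i n, a j • e (κ (t + j))‖ ≤
      ‖∑ j ∈ Finset.range n, a j • e j‖ := by
    have : ∑ j ∈ Finset.range i, a j • e j +
      (N : ℝ)⁻¹ • ∑ t ∈ Finset.range N, ∑ j ∈ Finset.Ico i n, a j • e (κ (t + j)) =
      (N : ℝ)⁻¹ • ∑ t ∈ Finset.range N, ∑ j ∈ Finset.range n,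
        a j • e (if j < i then j else κ (t + j)) := by
      have h2 : ∀ t, ∑ j ∈ Finset.range n, a j • e (if j < i then j else κ (t + j)) =
          ∑ j ∈ Finset.range i, a j • e j + ∑ j ∈ Finset.Ico i n, a j • e (κ (t + j)) := by
        intro t
        rw [← Finset.sum_range_add_sum_Ico _ hi]
        congr 1
        · exact Finset.sum_congr rfl fun j hj => by rw [if_pos (Finset.mem_range.1 hj)]
        · exact Finset.sum_congr rfl fun j hj => by
            rw [if_neg (not_lt.2 (Finset.mem_Ico.1 hj).1)]
      simp_rw [h2]
      rw [Finset.sum_add_distrib, Finset.sum_const, smul_add, Finset.card_range,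
        ← Nat.cast_smul_eq_nsmul ℝ, smul_smul, inv_mul_cancel₀ hN'.ne', one_smul]
    rw [this, norm_smul, norm_inv, Real.norm_natCast, inv_mul_le_iff₀ hN']
    refine (norm_sum_le _ _).trans ?_
    have h2 : ∀ t ∈ Finset.range N,
        ‖∑ j ∈ Finset.range n, a j • e (if j < i then j else κ (t + j))‖ =
          ‖∑ j ∈ Finset.range n, a j • e j‖ := by
      intro t _
      refine he.norm_sum_comp _ _ fun p q hpq => ?_
      have h3 := hκ (show t + p < t + q by omega)
      have h4 := hκ.id_le (t + q)
      dsimp only [id] at h4 ⊢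
      split_ifs <;> omega
    rw [Finset.sum_congr rfl h2]
    simp
  refine (norm_le_norm_add_norm_sub' _ _).trans (add_le_add h1 ?_)
  rw [add_sub_add_left_eq_sub, subseqMean, smul_comm, ← smul_sub, norm_smul, norm_inv,
    Real.norm_natCast, inv_mul_eq_div]
  refine div_le_div_of_nonneg_right ?_ hN'.le
  rw [Finset.sum_comm, Finset.sum_smul, ← Finset.sum_sub_distrib]
  refine (norm_sum_le _ _).trans (Finset.sum_le_sum fun j _ => ?_)
  rw [← Finset.smul_sum, ← smul_sub, norm_smul, Real.norm_eq_abs, norm_sub_rev]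
  refine mul_le_mul_of_nonneg_left ?_ (abs_nonneg _)
  exact norm_sum_range_shift_sub_le (x := fun t => e (κ t)) (fun t => (he.norm_eq _ _).le) N j

/-- If the basis constants of a spreading sequence are unbounded, a unit vector is almost
cancelled by a multiple of every long mean. -/
lemma IsSpreading.exists_norm_add_smul_subseqMean_le {e : ℕ → E} (he : IsSpreading e)
    (hC : ∀ C, ¬ HasBasisConstant e C) {ε : ℝ} (hε : 0 < ε) :
    ∃ (y : E) (σ : ℝ), ‖y‖ = 1 ∧ ∀ᶠ N : ℕ in atTop, ∀ κ : ℕ → ℕ, StrictMono κ →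
      ‖y + σ • subseqMean e κ N‖ ≤ ε := by
  -- This constant makes the whole combination smaller than `ε / 2` times its head; the other half
  -- of `ε` absorbs the shift error.
  have h := hC (ε / 2)⁻¹
  simp only [HasBasisConstant, not_forall, not_le] at h
  obtain ⟨n, a, i, hi, h⟩ := h
  set Y := ∑ j ∈ Finset.range i, a j • e j with hY
  have hY0 : 0 < ‖Y‖ := lt_of_le_of_lt (by positivity) h
  rw [inv_mul_lt_iff₀ (by positivity)] at h
  set K := ∑ j ∈ Finset.Ico i n, |a j| * (2 * j * ‖e 0‖) with hK
  refine ⟨‖Y‖⁻¹ • Y, ‖Y‖⁻¹ * ∑ j ∈ Finset.Ico i n, a j, ?_, ?_⟩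
  · rw [norm_smul, norm_inv, norm_norm, inv_mul_cancel₀ hY0.ne']
  have hlim : Tendsto (fun N : ℕ => K / N) atTop (𝓝 0) := tendsto_const_div_atTop_nhds_zero_nat K
  filter_upwards [hlim.eventually_lt_const (show 0 < ε / 2 * ‖Y‖ by positivity),
    eventually_gt_atTop 0] with N hN hN0 κ hκ
  have := he.norm_add_subseqMean_le hi a hκ hN0
  rw [mul_smul, ← smul_add, norm_smul, norm_inv, norm_norm, inv_mul_le_iff₀ hY0]
  linarith

lemma IsSpreading.exists_subseqMean_close {e : ℕ → E} (he : IsSpreading e)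
    (hC : ∀ C, ¬ HasBasisConstant e C) {η : ℝ} (hη : 0 < η) :
    ∃ w : E, ∀ᶠ N : ℕ in atTop, ∀ κ : ℕ → ℕ, StrictMono κ → ‖subseqMean e κ N - w‖ ≤ η := by
  set B := ‖e 0‖ with hB
  have hB0 : 0 ≤ B := norm_nonneg _
  -- The bound `1 / 2` forces `1 ≤ |σ| * (2 * B)`; with it, the other bound is at most `|σ| * η`, so
  -- division by `σ` leaves `η`.
  have hε : 0 < min (1 / 2) (η / (2 * B + 1)) := by positivity
  obtain ⟨y, σ, hy, h⟩ := he.exists_norm_add_smul_subseqMean_le hC hε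
  refine ⟨- (σ⁻¹ • y), ?_⟩
  filter_upwards [h] with N hN κ hκ
  have h1 := hN κ hκ
  have h2 := he.norm_subseqMean_le κ N
  have h3 : 1 ≤ |σ| * (2 * B) := by
    have h4 : ‖y‖ ≤ ‖y + σ • subseqMean e κ N‖ + ‖σ • subseqMean e κ N‖ := by
      simpa using norm_sub_le (y + σ • subseqMean e κ N) (σ • subseqMean e κ N)
    rw [hy, norm_smul, Real.norm_eq_abs] at h4
    have h5 := h1.trans (min_le_left _ _)
    have h6 := mul_le_mul_of_nonneg_left h2 (abs_nonneg σ)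
    linarith
  have hσ : σ ≠ 0 := by
    rintro rfl
    norm_num at h3
  have h4 : subseqMean e κ N - -(σ⁻¹ • y) = σ⁻¹ • (y + σ • subseqMean e κ N) := by
    rw [smul_add, smul_smul, inv_mul_cancel₀ hσ, one_smul]
    abel
  rw [h4, norm_smul, norm_inv, Real.norm_eq_abs, inv_mul_le_iff₀ (abs_pos.2 hσ)]
  refine (h1.trans (min_le_right _ _)).trans ?_
  rw [div_le_iff₀ (by positivity)]
  nlinarith [mul_le_mul_of_nonneg_left h3 hη.le, mul_nonneg (abs_nonneg σ) hη.le]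

end UnboundedBasisConstant

/-! ### The nonzero weak limit -/

section WeakLimit

variable {E : Type*} [NormedAddCommGroup E] [NormedSpace ℝ E]

/-- If the basis constants of a spreading sequence in a Banach space are unbounded, the means of
its subsequences converge uniformly to a nonzero vector. -/
lemma IsSpreading.exists_uniformMeanLimit [CompleteSpace E] {e : ℕ → E} (he : IsSpreading e)
    (hC : ∀ C, ¬ HasBasisConstant e C) : ∃ v : E, v ≠ 0 ∧ UniformMeanLimit e v := by
  have hcauchy : CauchySeq (subseqMean e id) := by
    rw [Metric.cauchySeq_iff]
    intro ε hε
    obtain ⟨w, hw⟩ := he.exists_subseqMean_close hC (show 0 < ε / 3 by positivity)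
    obtain ⟨N0, hN0⟩ := eventually_atTop.1 hw
    refine ⟨N0, fun m hm n hn => ?_⟩
    have h1 := hN0 m hm id strictMono_id
    have h2 := hN0 n hn id strictMono_id
    rw [← dist_eq_norm] at h1 h2
    linarith [dist_triangle_right (subseqMean e id m) (subseqMean e id n) w]
  obtain ⟨v, hv⟩ := cauchySeq_tendsto_of_complete hcauchy
  refine ⟨v, ?_, ?_⟩
  -- If the means tended to zero, the unit vector `y` would have norm at most `1 / 2`.
  · rintro rfl
    obtain ⟨y, σ, hy, h⟩ := he.exists_norm_add_smul_subseqMean_le hC one_half_pos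
    have h1 : Tendsto (fun N => ‖y + σ • subseqMean e id N‖) atTop (𝓝 ‖y + σ • (0 : E)‖) :=
      ((hv.const_smul σ).const_add y).norm
    have h2 := le_of_tendsto h1 (h.mono fun N hN => hN id strictMono_id)
    rw [smul_zero, add_zero, hy] at h2
    norm_num at h2
  · intro η hη
    obtain ⟨w, hw⟩ := he.exists_subseqMean_close hC (show 0 < η / 2 by positivity)
    have h1 : ‖v - w‖ ≤ η / 2 :=
      le_of_tendsto (hv.sub_const w).norm (hw.mono fun N hN => hN id strictMono_id)
    filter_upwards [hw] with N hN κ hκ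
    have h2 := norm_sub_le (subseqMean e κ N - w) (v - w)
    rw [sub_sub_sub_cancel_right] at h2
    linarith [hN κ hκ]

/-- If `f (e n) ≥ f v + ε` infinitely often, the means along those indices stay away from `v`,
against uniformity over subsequences. Applying this to `-f` gives the other side. -/
lemma UniformMeanLimit.weaklyConverges {e : ℕ → E} {v : E} (h : UniformMeanLimit e v) :
    WeaklyConverges e v := by
  have key : ∀ f : StrongDual ℝ E, ∀ ε > 0, ∀ᶠ n in atTop, f (e n) < f v + ε := by
    intro f ε hε
    by_contra hcon
    rw [not_eventually] at hcon
    obtain ⟨κ, hκ, hκ'⟩ := extraction_of_frequently_atTop hcon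
    have hη : 0 < ε / (2 * (‖f‖ + 1)) := by positivity
    obtain ⟨N, hN, hN0⟩ := ((h _ hη).and (eventually_gt_atTop 0)).exists
    have hN' : (0 : ℝ) < N := by positivity
    have h1 : f v + ε ≤ f (subseqMean e κ N) := by
      rw [subseqMean, map_smul, map_sum, smul_eq_mul, le_inv_mul_iff₀ hN']
      have := Finset.card_nsmul_le_sum (Finset.range N) (fun t => f (e (κ t))) (f v + ε)
        fun t _ => not_lt.1 (hκ' t)
      simpa [mul_add] using this
    have h2 : f (subseqMean e κ N) - f v ≤ ‖f‖ * (ε / (2 * (‖f‖ + 1))) := by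
      rw [← map_sub]
      exact ((le_abs_self _).trans (f.le_opNorm _)).trans
        (mul_le_mul_of_nonneg_left (hN κ hκ) (norm_nonneg _))
    have h3 : ‖f‖ * (ε / (2 * (‖f‖ + 1))) ≤ ε / 2 := by
      rw [mul_div_assoc', div_le_div_iff₀ (by positivity) (by positivity)]
      nlinarith [norm_nonneg f]
    linarith
  intro f
  rw [Metric.tendsto_nhds]
  intro ε hε
  filter_upwards [key f ε hε, key (-f) ε hε] with n h1 h2
  rw [Real.dist_eq, abs_lt]
  simp only [neg_apply] at h2
  constructor <;> linarith

end WeakLimit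

/-! ### The vectors of `c₀` indexed by pairs -/

section SpreadingModelConstruction

/-- A finitely supported real sequence, as an element of `c₀`. -/
noncomputable def CZero.ofFiniteSupport (x : ℕ → ℝ) (hx : (Function.support x).Finite) : CZero where
  toFun := x
  continuous_toFun := continuous_of_discreteTopology
  zero_at_infty' := by
    rw [cocompact_eq_cofinite]
    refine tendsto_const_nhds.congr' ?_
    filter_upwards [hx.compl_mem_cofinite] with n hn
    simpa using (Function.notMem_support.1 hn).symm

lemma CZero.ofFiniteSupport_apply (x : ℕ → ℝ) (hx : (Function.support x).Finite) (n : ℕ) :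
    CZero.ofFiniteSupport x hx n = x n := rfl

lemma CZero.abs_apply_le (x : CZero) (n : ℕ) : |x n| ≤ ‖x‖ := by
  rw [← ZeroAtInftyContinuousMap.norm_toBCF_eq_norm]
  exact x.toBCF.norm_coe_le_norm n

lemma CZero.norm_le {x : CZero} {r : ℝ} (hr : 0 ≤ r) (h : ∀ n, |x n| ≤ r) : ‖x‖ ≤ r := by
  rw [← ZeroAtInftyContinuousMap.norm_toBCF_eq_norm]
  exact (BoundedContinuousFunction.norm_le hr).2 h

lemma CZero.sum_smul_apply {ι : Type*} (s : Finset ι) (a : ι → ℝ) (x : ι → CZero) (n : ℕ) :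
    (∑ j ∈ s, a j • x j) n = ∑ j ∈ s, a j * x j n := by
  classical
  induction s using Finset.induction_on with
  | empty => simp
  | insert i s hi ih => rw [Finset.sum_insert hi, Finset.sum_insert hi,
      ZeroAtInftyContinuousMap.add_apply, ih]; rfl

variable {G : Type*} [NormedAddCommGroup G] [NormedSpace ℝ G]

/-- Finitely many functionals of norm at most one nearly norm the combinations of the first
`n + 1` terms with coefficients in `[-1, 1]`. -/
lemma exists_finite_norming (g : ℕ → G) (n : ℕ) {ε : ℝ} (hε : 0 < ε) :
    ∃ (L : ℕ) (f : ℕ → StrongDual ℝ G), (∀ i, ‖f i‖ ≤ 1) ∧ (∀ i, L ≤ i → f i = 0) ∧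
      ∀ b : ℕ → ℝ, (∀ j, |b j| ≤ 1) → ∃ i,
        ‖∑ j ∈ Finset.range (n + 1), b j • g j‖ ≤
          f i (∑ j ∈ Finset.range (n + 1), b j • g j) + ε := by
  let T : (Fin (n + 1) → ℝ) → G := fun b => ∑ j, b j • g j
  have hT : Continuous T := by fun_prop
  have hK : IsCompact (T '' Set.Icc (-1) 1) := isCompact_Icc.image hT
  -- Norming functionals of an `ε / 2`-net suffice: passing to the net point costs `ε / 2` in the
  -- norm and `ε / 2` in the functional.
  obtain ⟨t, -, htf, ht⟩ := hK.finite_cover_balls (half_pos hε)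
  choose F hF1 hF2 using fun y : G => exists_dual_vector'' ℝ y
  let l := htf.toFinset.toList
  refine ⟨l.length, fun i => if h : i < l.length then F l[i] else 0, ?_, ?_, ?_⟩
  · intro i
    dsimp only
    split_ifs
    exacts [hF1 _, by simp]
  · intro i hi
    simp [not_lt.2 hi]
  · intro b hb
    have hmem : T (fun j => b j) ∈ T '' Set.Icc (-1) 1 := by
      refine ⟨_, ⟨fun j => (abs_le.1 (hb j)).1, fun j => (abs_le.1 (hb j)).2⟩, rfl⟩
    have hTb : T (fun j => b j) = ∑ j ∈ Finset.range (n + 1), b j • g j :=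
      Fin.sum_univ_eq_sum_range (fun j => b j • g j) (n + 1)
    rw [hTb] at hmem
    set y := ∑ j ∈ Finset.range (n + 1), b j • g j
    obtain ⟨z, hz, hyz⟩ := Set.mem_iUnion₂.1 (ht hmem)
    have hzl : z ∈ l := by simpa [l] using hz
    obtain ⟨i, hi, rfl⟩ := List.getElem_of_mem hzl
    refine ⟨i, ?_⟩
    simp only [dif_pos hi]
    rw [Metric.mem_ball, dist_eq_norm] at hyz
    have h1 : |F l[i] (y - l[i])| ≤ 1 * ‖y - l[i]‖ :=
      ((F l[i]).le_opNorm _).trans (mul_le_mul_of_nonneg_right (hF1 _) (norm_nonneg _))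
    have h2 := hF2 l[i]
    simp only [RCLike.ofReal_real_eq_id, id] at h2
    rw [map_sub, abs_le] at h1
    have h3 := norm_sub_norm_le y l[i]
    linarith [h1.1]

/-- A downward closed predicate on `{0, …, n - 1}` singles out an initial segment. -/
lemma exists_initial_segment (n : ℕ) (p : ℕ → Prop)
    (hp : ∀ i j, i ≤ j → j < n → p j → p i) : ∃ q ≤ n, ∀ j < n, p j ↔ j < q := by
  by_cases h : ∃ q, q < n ∧ ¬ p q
  · classical
    refine ⟨Nat.find h, (Nat.find_spec h).1.le, fun j hj => ⟨fun hpj => ?_, fun hjq => ?_⟩⟩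
    · by_contra hlt
      exact (Nat.find_spec h).2 (hp _ j (not_lt.1 hlt) hj hpj)
    · by_contra hpj
      exact Nat.find_min h hjq ⟨hj, hpj⟩
  · push Not at h
    exact ⟨n, le_rfl, fun j hj => ⟨fun _ => hj, fun _ => h j hj⟩⟩

/-- Passing to an interval of indices does not increase the norm of linear combinations. -/
def IsIntervalSuppressing (g : ℕ → G) : Prop :=
  ∀ (n : ℕ) (a : ℕ → ℝ) (p q : ℕ), p ≤ q → q ≤ n →
    ‖∑ j ∈ Finset.Ico p q, a j • g j‖ ≤ ‖∑ j ∈ Finset.range n, a j • g j‖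

lemma IsIntervalSuppressing.norm_sum_filter_le {g : ℕ → G} (hg : IsIntervalSuppressing g) (n : ℕ)
    (a : ℕ → ℝ) (p : ℕ → Prop) [DecidablePred p]
    (hp : (∀ i j, i ≤ j → j < n → p j → p i) ∨ (∀ i j, i ≤ j → j < n → p i → p j)) :
    ‖∑ j ∈ Finset.range n with p j, a j • g j‖ ≤ ‖∑ j ∈ Finset.range n, a j • g j‖ := by
  rcases hp with hp | hp
  · obtain ⟨q, hq, h⟩ := exists_initial_segment n p hp
    have : (Finset.range n).filter p = Finset.Ico 0 q := by
      ext j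
      simp only [Finset.mem_filter, Finset.mem_range, Finset.mem_Ico]
      exact ⟨fun hj => ⟨j.zero_le, (h j hj.1).1 hj.2⟩,
        fun hj => ⟨hj.2.trans_le hq, (h j (hj.2.trans_le hq)).2 hj.2⟩⟩
    rw [this]
    exact hg n a 0 q q.zero_le hq
  · obtain ⟨q, hq, h⟩ := exists_initial_segment n (fun j => ¬ p j)
      fun i j hij hj hpj hpi => hpj (hp i j hij hj hpi)
    have : (Finset.range n).filter p = Finset.Ico q n := by
      ext j
      simp only [Finset.mem_filter, Finset.mem_range, Finset.mem_Ico]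
      constructor
      · rintro ⟨hj, hpj⟩
        exact ⟨not_lt.1 fun hjq => (h j hj).2 hjq hpj, hj⟩
      · rintro ⟨hqj, hj⟩
        exact ⟨hj, by_contra fun hpj => not_lt.2 hqj ((h j hj).1 hpj)⟩
    rw [this]
    exact hg n a q n hq le_rfl

/-- The coordinates of the vector of `c₀` attached to a pair: the first one is `c`, the others are
the values at `g (s 0)` of the functionals of the levels between `s 0` and `s 1`. -/
noncomputable def pairCoord (c : ℝ) (g : ℕ → G) (f : ℕ → ℕ → StrongDual ℝ G) (s : KSubset 2) :
    ℕ → ℝ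
  | 0 => c
  | k + 1 => if s 0 ≤ k.unpair.1 ∧ k.unpair.1 < s 1 then f k.unpair.1 k.unpair.2 (g (s 0)) else 0

lemma support_pairCoord_finite (c : ℝ) (g : ℕ → G) {f : ℕ → ℕ → StrongDual ℝ G} {L : ℕ → ℕ}
    (hf : ∀ n i, L n ≤ i → f n i = 0) (s : KSubset 2) :
    (Function.support (pairCoord c g f s)).Finite := by
  have hfin : (insert 0 ((fun z : ℕ × ℕ => Nat.pair z.1 z.2 + 1) ''
      (⋃ n ∈ Finset.range (s 1), {n} ×ˢ Set.Iio (L n)))).Finite := by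
    refine Set.Finite.insert _ (Set.Finite.image _ ?_)
    exact Set.Finite.biUnion (Finset.finite_toSet _) fun n _ =>
      (Set.finite_singleton n).prod (Set.finite_Iio _)
  refine hfin.subset fun k hk => ?_
  cases k with
  | zero => simp
  | succ k =>
    refine Or.inr ⟨k.unpair, ?_, by simp⟩
    simp only [Function.mem_support, pairCoord, ne_eq, ite_eq_right_iff, Classical.not_imp] at hk
    simp only [Set.mem_iUnion]
    refine ⟨k.unpair.1, Finset.mem_range.2 hk.1.2, rfl, ?_⟩
    by_contra h
    apply hk.2
    rw [hf _ _ (not_lt.1 h)]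
    rfl

variable {F : Type*} [SeminormedAddCommGroup F] [NormedSpace ℝ F]

/-- A linearly independent sequence whose norm is the maximum of a multiple of the sum of the
coefficients and of the norm of an interval suppressing spreading sequence is a `2`-spreading model
of `c₀`. -/
theorem isSpreadingModel_of_norm_eq_max {c : ℝ} (hc : 0 ≤ c) {g : ℕ → G} (hgs : IsSpreading g)
    (hgi : IsIntervalSuppressing g) {u : ℕ → F} (hu : LinearIndependent ℝ u)
    (hnorm : ∀ (n : ℕ) (a : ℕ → ℝ), ‖∑ j ∈ Finset.range n, a j • u j‖ =
      max (|∑ j ∈ Finset.range n, a j| * c) ‖∑ j ∈ Finset.range n, a j • g j‖) :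
    IsSpreadingModel CZero 2 u := by
  choose L f hf1 hf0 hf using fun n : ℕ =>
    exists_finite_norming g n (ε := 1 / ((n : ℝ) + 1)) Nat.one_div_pos_of_nat
  let x : KSubset 2 → CZero := fun s =>
    CZero.ofFiniteSupport (pairCoord c g f s) (support_pairCoord_finite c g hf0 s)
  -- With `M = id`, a family starting at or beyond `l` has its norming level at or beyond `l`, where
  -- the tolerance is at most `1 / (l + 1)`.
  refine ⟨x, id, strictMono_id, hu, fun l => 1 / ((l : ℝ) + 1), fun l => Nat.one_div_pos_of_nat,
    tendsto_one_div_add_atTop_nhds_zero_nat, ?_⟩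
  intro m l hml s _ hs hl a ha
  obtain ⟨b, rfl⟩ := exists_nat_extension a
  have hs0 : StrictMono fun j => s j 0 := hs.1 0
  have hs1 : StrictMono fun j => s j 1 := hs.1 1
  have hs01 : s (Fin.last m) 0 < s 0 1 := hs.2 0 (by norm_num)
  have hu' : ‖∑ j : Fin (m + 1), b j • u j‖ =
      max (|∑ j : Fin (m + 1), b j| * c) ‖∑ j : Fin (m + 1), b j • g j‖ := by
    rw [Fin.sum_univ_eq_sum_range (fun j => b j • u j), Fin.sum_univ_eq_sum_range b,
      Fin.sum_univ_eq_sum_range (fun j => b j • g j), hnorm]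
  have hupper : ‖∑ j : Fin (m + 1), b j • x (s j)‖ ≤ ‖∑ j : Fin (m + 1), b j • u j‖ := by
    refine CZero.norm_le (norm_nonneg _) fun k => ?_
    rw [CZero.sum_smul_apply, hu']
    cases k with
    | zero =>
      refine le_max_of_le_left ?_
      have : ∑ j : Fin (m + 1), b j * x (s j) 0 = (∑ j : Fin (m + 1), b j) * c := by
        rw [Finset.sum_mul]
        rfl
      rw [this, abs_mul, abs_of_nonneg hc]
    | succ k =>
      refine le_max_of_le_right ?_
      set n := k.unpair.1 with hn
      set i := k.unpair.2 with hi
      have h1 : ∑ j : Fin (m + 1), b j * x (s j) (k + 1) =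
          f n i (∑ j : Fin (m + 1) with s j 0 ≤ n ∧ n < s j 1, b j • g (s j 0)) := by
        rw [Finset.sum_filter, map_sum]
        refine Finset.sum_congr rfl fun j _ => ?_
        have : x (s j) (k + 1) = if s j 0 ≤ n ∧ n < s j 1 then f n i (g (s j 0)) else 0 := rfl
        rw [this]
        split_ifs <;> simp
      rw [h1]
      have h2 : |f n i (∑ j : Fin (m + 1) with s j 0 ≤ n ∧ n < s j 1, b j • g (s j 0))| ≤
          1 * ‖∑ j : Fin (m + 1) with s j 0 ≤ n ∧ n < s j 1, b j • g (s j 0)‖ :=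
        ((f n i).le_opNorm _).trans (mul_le_mul_of_nonneg_right (hf1 n i) (norm_nonneg _))
      refine h2.trans ?_
      rw [one_mul, hgs.norm_sum_eq _ (fun j : Fin (m + 1) => b j) (hs0.strictMonoOn _)
        (g := fun j => (j : ℕ)) (Fin.val_strictMono.strictMonoOn _)]
      classical
      let p : ℕ → Prop := fun j => ∃ h : j < m + 1, s ⟨j, h⟩ 0 ≤ n ∧ n < s ⟨j, h⟩ 1
      have h3 : ∑ j : Fin (m + 1) with s j 0 ≤ n ∧ n < s j 1, b j • g j =
          ∑ j ∈ Finset.range (m + 1) with p j, b j • g j := by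
        rw [Finset.sum_filter, Finset.sum_filter,
          ← Fin.sum_univ_eq_sum_range (fun j => if p j then b j • g j else 0)]
        refine Finset.sum_congr rfl fun j _ => ?_
        simp [p, Nat.le_of_lt_succ j.2]
      rw [h3, Fin.sum_univ_eq_sum_range (fun j => b j • g j)]
      refine hgi.norm_sum_filter_le _ _ _ ?_
      -- Before `s 0 1` no member has ended, so the active ones form an initial segment. From `s 0
      -- 1` on all have begun, so they form a final one.
      rcases lt_or_ge n (s 0 1) with hlt | hge
      · left
        rintro i j hij hj ⟨_, hp, _⟩
        have hi := hij.trans_lt hj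
        have hle : s ⟨i, hi⟩ 0 ≤ s ⟨j, hj⟩ 0 := hs0.monotone hij
        have hle' : s 0 1 ≤ s ⟨i, hi⟩ 1 := hs1.monotone (Fin.zero_le _)
        exact ⟨hi, hle.trans hp, hlt.trans_le hle'⟩
      · right
        rintro i j hij hj ⟨hi, _, hp⟩
        have hle : s ⟨j, hj⟩ 0 ≤ s (Fin.last m) 0 := hs0.monotone (Fin.le_last _)
        have hle' : s ⟨i, hi⟩ 1 ≤ s ⟨j, hj⟩ 1 := hs1.monotone hij
        exact ⟨hj, (hle.trans hs01.le).trans hge, hp.trans_le hle'⟩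
  have hlower : ‖∑ j : Fin (m + 1), b j • u j‖ ≤ ‖∑ j : Fin (m + 1), b j • x (s j)‖ + 1 / ((l : ℝ) + 1) := by
    rw [hu']
    refine max_le ?_ ?_
    · have h1 := CZero.abs_apply_le (∑ j : Fin (m + 1), b j • x (s j)) 0
      rw [CZero.sum_smul_apply] at h1
      have : ∑ j : Fin (m + 1), b j * x (s j) 0 = (∑ j : Fin (m + 1), b j) * c := by
        rw [Finset.sum_mul]
        rfl
      rw [this, abs_mul, abs_of_nonneg hc] at h1
      have : (0 : ℝ) < 1 / ((l : ℝ) + 1) := Nat.one_div_pos_of_nat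
      linarith
    · set n := s (Fin.last m) 0 with hn
      classical
      -- The coefficients are placed at the positions `s j 0`, with zeros elsewhere, since the
      -- functionals of level `n` norm combinations of all of `g 0, …, g n`.
      let d : ℕ → ℝ := fun k => if h : ∃ j : Fin (m + 1), s j 0 = k then b h.choose else 0
      have hd : ∀ j : Fin (m + 1), d (s j 0) = b j := by
        intro j
        have h : ∃ j' : Fin (m + 1), s j' 0 = s j 0 := ⟨j, rfl⟩
        have h2 : h.choose = j := hs0.injective h.choose_spec
        simp only [d, dif_pos h]
        rw [h2]
      have hd1 : ∀ k, |d k| ≤ 1 := by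
        intro k
        simp only [d]
        split_ifs with h
        · exact abs_le.2 (ha _)
        · simp
      have hsum : ∑ k ∈ Finset.range (n + 1), d k • g k = ∑ j : Fin (m + 1), b j • g (s j 0) := by
        symm
        rw [← Finset.sum_image (s := Finset.univ) (g := fun j : Fin (m + 1) => s j 0)
          (f := fun k => d k • g k) (fun i _ j _ hij => hs0.injective hij) |>.trans
          (Finset.sum_congr rfl fun j _ => by rw [hd j])]
        refine Finset.sum_subset ?_ ?_
        · intro k hk
          obtain ⟨j, -, rfl⟩ := Finset.mem_image.1 hk
          exact Finset.mem_range.2 (Nat.lt_succ_of_le (hs0.monotone (Fin.le_last j)))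
        · intro k _ hk
          have : ¬ ∃ j : Fin (m + 1), s j 0 = k := fun ⟨j, hj⟩ =>
            hk (Finset.mem_image.2 ⟨j, Finset.mem_univ _, hj⟩)
          simp only [d, dif_neg this, zero_smul]
      obtain ⟨i, hi⟩ := hf n d hd1
      rw [hsum] at hi
      rw [hgs (m + 1) (fun j => b j) (fun j => s j 0) hs0]
      have h1 := CZero.abs_apply_le (∑ j : Fin (m + 1), b j • x (s j)) (Nat.pair n i + 1)
      rw [CZero.sum_smul_apply] at h1
      have h2 : ∑ j : Fin (m + 1), b j * x (s j) (Nat.pair n i + 1) =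
          f n i (∑ j : Fin (m + 1), b j • g (s j 0)) := by
        rw [map_sum]
        refine Finset.sum_congr rfl fun j _ => ?_
        have h3 : x (s j) (Nat.pair n i + 1) = f n i (g (s j 0)) := by
          have hj0 : s j 0 ≤ n := hs0.monotone (Fin.le_last j)
          have hj1 : n < s j 1 := hs01.trans_le (hs1.monotone (Fin.zero_le j))
          simp [x, CZero.ofFiniteSupport_apply, pairCoord, hj0, hj1]
        rw [h3]
        simp
      rw [h2] at h1
      have hln : l ≤ n := (show l ≤ s 0 0 from hl).trans (hs0.monotone (Fin.zero_le _))
      have h4 : 1 / ((n : ℝ) + 1) ≤ 1 / ((l : ℝ) + 1) := Nat.one_div_le_one_div hln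
      linarith [le_abs_self (f n i (∑ j : Fin (m + 1), b j • g (s j 0)))]
  have : (0 : ℝ) < 1 / ((l : ℝ) + 1) := Nat.one_div_pos_of_nat
  rw [abs_le]
  constructor <;> linarith

end SpreadingModelConstruction

/-! ### Basis constants and Schauder bases -/

section SchauderBases

variable {E : Type*} [NormedAddCommGroup E] [NormedSpace ℝ E]

lemma IsBimonotoneSchauderBasic.isIntervalSuppressing {e : ℕ → E}
    (h : IsBimonotoneSchauderBasic e) : IsIntervalSuppressing e := by
  obtain ⟨b, hb, hproj⟩ := h
  intro n a p q hpq hqn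
  have h1 := (GeneralSchauderBasis.proj b (Finset.Ico p q)).le_of_opNorm_le (hproj p q)
    (∑ j ∈ Finset.range n, a j • b j)
  have h2 : GeneralSchauderBasis.proj b (Finset.Ico p q) (∑ j ∈ Finset.range n, a j • b j) =
      ∑ j ∈ Finset.Ico p q, a j • b j := by
    have hsub : Finset.Ico p q ⊆ Finset.range n := fun j hj =>
      Finset.mem_range.2 ((Finset.mem_Ico.1 hj).2.trans_le hqn)
    rw [map_sum, ← Finset.sum_subset hsub]
    · refine Finset.sum_congr rfl fun j hj => ?_
      rw [map_smul, GeneralSchauderBasis.proj_apply_basis_mem, if_pos hj]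
    · intro j _ hj
      rw [map_smul, GeneralSchauderBasis.proj_apply_basis_mem, if_neg hj, smul_zero]
  rw [h2, one_mul, ← Submodule.norm_coe, ← Submodule.norm_coe] at h1
  simpa [hb] using h1

lemma IsSchauderBasic.linearIndependent {e : ℕ → E} (h : IsSchauderBasic e) :
    LinearIndependent ℝ e := by
  obtain ⟨b, hb⟩ := h
  have : e = (closedSpan e).subtype ∘ b := funext fun n => (hb n).symm
  rw [this]
  exact b.linearIndependent.map' _ (Submodule.ker_subtype _)

lemma exists_sum_range_eq_of_mem_span {e : ℕ → E} {x : E}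
    (hx : x ∈ Submodule.span ℝ (Set.range e)) :
    ∃ (n : ℕ) (a : ℕ → ℝ), (∀ j, n ≤ j → a j = 0) ∧ x = ∑ j ∈ Finset.range n, a j • e j := by
  obtain ⟨a, rfl⟩ := (Finsupp.mem_span_range_iff_exists_finsupp).1 hx
  obtain ⟨n, hn⟩ := a.support.exists_nat_subset_range
  refine ⟨n, a, fun j hj => ?_, ?_⟩
  · by_contra h
    exact not_lt.2 hj (Finset.mem_range.1 (hn (Finsupp.mem_support_iff.2 h)))
  · exact Finset.sum_subset hn fun j _ hj => by
      simp [Finsupp.notMem_support_iff.1 hj]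

lemma HasBasisConstant.nonneg {e : ℕ → E} {C : ℝ} (hC : HasBasisConstant e C) (h0 : e 0 ≠ 0) :
    0 ≤ C := by
  have := hC 1 (fun _ => 1) 1 le_rfl
  simp only [Finset.sum_range_one, one_smul] at this
  have h1 : 0 < ‖e 0‖ := norm_pos_iff.2 h0
  by_contra hneg
  nlinarith

/-- A single term is the difference of two consecutive initial sums. -/
lemma HasBasisConstant.abs_coeff_le {e : ℕ → E} {C : ℝ} (hC : HasBasisConstant e C)
    (h0 : ∀ n, e n ≠ 0) (i n : ℕ) (a : ℕ → ℝ) (ha : ∀ j, n ≤ j → a j = 0) :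
    |a i| ≤ 2 * C / ‖e i‖ * ‖∑ j ∈ Finset.range n, a j • e j‖ := by
  have hC0 := hC.nonneg (h0 0)
  rw [div_mul_eq_mul_div, le_div_iff₀ (norm_pos_iff.2 (h0 i))]
  rcases lt_or_ge i n with hi | hi
  · have h1 := hC n a (i + 1) hi
    have h2 := hC n a i hi.le
    have h3 : a i • e i = ∑ j ∈ Finset.range (i + 1), a j • e j -
        ∑ j ∈ Finset.range i, a j • e j := by
      rw [Finset.sum_range_succ]
      abel
    have h4 := norm_sub_le_of_le h1 h2
    rw [← h3, norm_smul, Real.norm_eq_abs] at h4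
    linarith
  · rw [ha i hi, abs_zero, zero_mul]
    positivity

lemma HasBasisConstant.linearIndependent {e : ℕ → E} {C : ℝ} (hC : HasBasisConstant e C)
    (h0 : ∀ n, e n ≠ 0) : LinearIndependent ℝ e := by
  rw [linearIndependent_iff]
  intro a ha
  ext i
  obtain ⟨n, hn⟩ := a.support.exists_nat_subset_range
  have hsum : ∑ j ∈ Finset.range n, a j • e j = 0 := by
    rw [← ha, Finsupp.linearCombination_apply, Finsupp.sum]
    exact (Finset.sum_subset hn fun j _ hj => by
      rw [Finsupp.notMem_support_iff.1 hj, zero_smul]).symm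
  have h1 := hC.abs_coeff_le h0 i n a fun j hj => by
    by_contra h
    exact not_lt.2 hj (Finset.mem_range.1 (hn (Finsupp.mem_support_iff.2 h)))
  rw [hsum, norm_zero, mul_zero] at h1
  exact abs_nonpos_iff.1 h1

/-- The coefficient bound makes the coordinate continuous on the span; Hahn–Banach extends it. -/
lemma HasBasisConstant.exists_coord {e : ℕ → E} {C : ℝ} (hC : HasBasisConstant e C)
    (h0 : ∀ n, e n ≠ 0) (i : ℕ) :
    ∃ f : StrongDual ℝ E, ∀ j, f (e j) = if j = i then 1 else 0 := by
  have hli := hC.linearIndependent h0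
  let b := Module.Basis.span hli
  have hb : ∀ j, (b j : E) = e j := fun j =>
    congrArg Subtype.val (Module.Basis.span_apply hli j)
  let φ : StrongDual ℝ (Submodule.span ℝ (Set.range e)) :=
    (b.coord i).mkContinuous (2 * C / ‖e i‖) fun x => by
      obtain ⟨n, a, ha, hx⟩ := exists_sum_range_eq_of_mem_span x.2
      have hx' : x = ∑ j ∈ Finset.range n, a j • b j := Subtype.ext (by simp [hx, hb])
      have h1 : b.coord i x = a i := by
        rw [hx', map_sum]
        simp only [map_smul, Module.Basis.coord_apply, Module.Basis.repr_self, smul_eq_mul,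
          Finsupp.single_apply, mul_ite, mul_one, mul_zero, Finset.sum_ite_eq', Finset.mem_range]
        split_ifs with h
        · rfl
        · exact (ha i (not_lt.1 h)).symm
      rw [h1, ← Submodule.norm_coe, hx]
      exact hC.abs_coeff_le h0 i n a ha
  obtain ⟨f, hf, -⟩ := exists_extension_norm_eq _ φ
  refine ⟨f, fun j => ?_⟩
  rw [← hb j, hf (b j)]
  simp [φ, Finsupp.single_apply]

/-- A sequence of nonzero vectors with a finite basis constant is Schauder basic. -/
lemma HasBasisConstant.isSchauderBasic {e : ℕ → E} {C : ℝ} (hC : HasBasisConstant e C)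
    (h0 : ∀ n, e n ≠ 0) : IsSchauderBasic e := by
  choose f hf using hC.exists_coord h0
  have hC0 := hC.nonneg (h0 0)
  have hspan : ∀ (N : ℕ) (a : ℕ → ℝ) (n : ℕ), ∑ i ∈ Finset.range n,
      f i (∑ j ∈ Finset.range N, a j • e j) • e i = ∑ i ∈ Finset.range (min n N), a i • e i := by
    intro N a n
    have hcoord : ∀ i, f i (∑ j ∈ Finset.range N, a j • e j) = if i < N then a i else 0 := by
      intro i
      simp [hf]
    simp only [hcoord, ite_smul, zero_smul]
    rw [← Finset.sum_filter]
    congr 1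
    ext i
    simp
  let Q : ℕ → E →L[ℝ] E := fun n => ∑ i ∈ Finset.range n, (f i).smulRight (e i)
  have hQ : ∀ n x, Q n x = ∑ i ∈ Finset.range n, f i x • e i := by
    intro n x
    simp [Q]
  have hQC : ∀ n, ∀ x ∈ closedSpan e, ‖Q n x‖ ≤ C * ‖x‖ := by
    intro n x hx
    have hclosed : IsClosed {x : E | ‖Q n x‖ ≤ C * ‖x‖} :=
      isClosed_le (by fun_prop) (by fun_prop)
    refine closure_minimal ?_ hclosed hx
    intro y hy
    obtain ⟨N, a, -, rfl⟩ := exists_sum_range_eq_of_mem_span hy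
    rw [Set.mem_ofPred_eq, hQ, hspan]
    exact hC N a _ (min_le_right _ _)
  have hlim : ∀ x ∈ closedSpan e, Tendsto (fun n => Q n x) atTop (𝓝 x) := by
    intro x hx
    rw [Metric.tendsto_atTop]
    intro ε hε
    -- Once `Q n` fixes `y`, the error at `x` is at most `(C + 1) * ‖x - y‖`.
    obtain ⟨y, hy, hxy⟩ := Metric.mem_closure_iff.1 hx (ε / (C + 1)) (by positivity)
    obtain ⟨N, a, -, rfl⟩ := exists_sum_range_eq_of_mem_span hy
    refine ⟨N, fun n hn => ?_⟩
    set y := ∑ j ∈ Finset.range N, a j • e j with hydef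
    have h1 : Q n y = y := by rw [hQ, hspan, min_eq_right hn]
    have hmem : x - y ∈ closedSpan e :=
      Submodule.sub_mem _ hx (Submodule.le_topologicalClosure _ hy)
    have h2 := hQC n _ hmem
    rw [dist_eq_norm] at hxy ⊢
    have h3 : Q n x - x = Q n (x - y) - (x - y) := by
      rw [map_sub, h1]
      abel
    rw [h3]
    have h4 := norm_sub_le (Q n (x - y)) (x - y)
    rw [lt_div_iff₀ (by positivity)] at hxy
    nlinarith
  have hmem : ∀ n, e n ∈ closedSpan e := fun n =>
    Submodule.le_topologicalClosure _ (Submodule.subset_span ⟨n, rfl⟩)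
  refine ⟨{ basis := fun n => ⟨e n, hmem n⟩
            coord := fun i => (f i).comp (closedSpan e).subtypeL
            ortho := fun i j => ?_
            expansion := fun x => ?_ }, fun n => rfl⟩
  · simp [hf, Pi.single_apply, eq_comm]
  · rw [HasSum, SummationFilter.conditional_filter_eq_map_range, tendsto_map'_iff,
      tendsto_subtype_rng]
    refine (hlim x x.2).congr fun n => ?_
    simp [hQ]

end SchauderBases

/-! ### Renorming by interval sums -/

section Renorming

variable {E : Type*} [NormedAddCommGroup E] [NormedSpace ℝ E]

/-- The sequence whose linear combinations record the interval sums of combinations of `e`. -/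
noncomputable def intervalSums (e : ℕ → E) (j : ℕ) : BoundedContinuousFunction (ℕ × ℕ) E :=
  BoundedContinuousFunction.ofNormedAddCommGroupDiscrete
    (fun z => if z.1 ≤ j ∧ j < z.2 then e j else 0) ‖e j‖ fun z => by
      split_ifs <;> simp

lemma sum_intervalSums_apply (e : ℕ → E) (s : Finset ℕ) (a : ℕ → ℝ) (k : ℕ → ℕ) (p q : ℕ) :
    (∑ j ∈ s, a j • intervalSums e (k j)) (p, q) =
      ∑ j ∈ s with p ≤ k j ∧ k j < q, a j • e (k j) := by
  rw [BoundedContinuousFunction.sum_apply, Finset.sum_filter]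
  refine Finset.sum_congr rfl fun j _ => ?_
  simp [intervalSums]

lemma norm_filter_le_norm_sum_intervalSums (e : ℕ → E) (s : Finset ℕ) (a : ℕ → ℝ) (k : ℕ → ℕ)
    (p q : ℕ) :
    ‖∑ j ∈ s with p ≤ k j ∧ k j < q, a j • e (k j)‖ ≤
      ‖∑ j ∈ s, a j • intervalSums e (k j)‖ := by
  rw [← sum_intervalSums_apply]
  exact BoundedContinuousFunction.norm_coe_le_norm _ _

/-- Intervals of `j` and intervals of `k j` select the same sets of terms: `[p, q)` corresponds to
`[k p, k q)`, and the preimage of an interval under `k` is an interval. -/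
lemma isSpreading_intervalSums {e : ℕ → E} (he : IsSpreading e) :
    IsSpreading (intervalSums e) := by
  apply isSpreading_of_range
  intro n a k hk
  refine le_antisymm ?_ ?_
  · refine (BoundedContinuousFunction.norm_le (norm_nonneg _)).2 fun ⟨p, q⟩ => ?_
    rw [sum_intervalSums_apply e _ a (fun j => j), ← he.norm_sum_comp _ _ hk]
    have := norm_filter_le_norm_sum_intervalSums e (Finset.range n) a k (k p) (k q)
    simpa only [hk.le_iff_le, hk.lt_iff_lt] using this
  · refine (BoundedContinuousFunction.norm_le (norm_nonneg _)).2 fun ⟨p, q⟩ => ?_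
    rw [sum_intervalSums_apply, he.norm_sum_comp _ _ hk]
    obtain ⟨p', -, hp'⟩ := exists_initial_segment n (fun j => k j < p)
      fun i j hij _ hj => (hk.monotone hij).trans_lt hj
    obtain ⟨q', -, hq'⟩ := exists_initial_segment n (fun j => k j < q)
      fun i j hij _ hj => (hk.monotone hij).trans_lt hj
    have h1 : (Finset.range n).filter (fun j => p ≤ k j ∧ k j < q) =
        (Finset.range n).filter (fun j => p' ≤ j ∧ j < q') := by
      refine Finset.filter_congr fun j hj => ?_
      rw [← hq' j (Finset.mem_range.1 hj), ← not_lt, hp' j (Finset.mem_range.1 hj), not_lt]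
    rw [h1]
    exact norm_filter_le_norm_sum_intervalSums e (Finset.range n) a (fun j => j) p' q'

lemma isIntervalSuppressing_intervalSums (e : ℕ → E) :
    IsIntervalSuppressing (intervalSums e) := by
  intro n a p q _ hqn
  refine (BoundedContinuousFunction.norm_le (norm_nonneg _)).2 fun ⟨p', q'⟩ => ?_
  rw [sum_intervalSums_apply e _ a (fun j => j)]
  have := norm_filter_le_norm_sum_intervalSums e (Finset.range n) a (fun j => j)
    (max p p') (min q q')
  have h : (Finset.Ico p q).filter (fun j => p' ≤ j ∧ j < q') =
      (Finset.range n).filter (fun j => max p p' ≤ j ∧ j < min q q') := by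
    ext j
    simp only [Finset.mem_filter, Finset.mem_Ico, Finset.mem_range]
    omega
  rwa [h]

lemma norm_le_norm_sum_intervalSums (e : ℕ → E) (n : ℕ) (a : ℕ → ℝ) :
    ‖∑ j ∈ Finset.range n, a j • e j‖ ≤ ‖∑ j ∈ Finset.range n, a j • intervalSums e j‖ := by
  have := norm_filter_le_norm_sum_intervalSums e (Finset.range n) a (fun j => j) 0 n
  rwa [Finset.filter_true_of_mem (by simp)] at this

/-- An interval sum is the difference of two initial sums, hence the factor `2`. -/
lemma HasBasisConstant.norm_sum_intervalSums_le {e : ℕ → E} {C : ℝ} (hC : HasBasisConstant e C)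
    (hC0 : 0 ≤ C) (n : ℕ) (a : ℕ → ℝ) :
    ‖∑ j ∈ Finset.range n, a j • intervalSums e j‖ ≤
      2 * C * ‖∑ j ∈ Finset.range n, a j • e j‖ := by
  refine (BoundedContinuousFunction.norm_le (by positivity)).2 fun ⟨p, q⟩ => ?_
  rw [sum_intervalSums_apply e _ a (fun j => j)]
  have h1 : (Finset.range n).filter (fun j => p ≤ j ∧ j < q) = Finset.Ico p (min q n) := by
    ext j
    simp only [Finset.mem_filter, Finset.mem_Ico, Finset.mem_range]
    omega
  rw [h1]
  rcases le_total p (min q n) with h | h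
  · rw [Finset.sum_Ico_eq_sub _ h]
    refine (norm_sub_le_of_le (hC n a _ (min_le_right _ _))
      (hC n a p (h.trans (min_le_right _ _)))).trans_eq ?_
    ring
  · rw [Finset.Ico_eq_empty_of_le h]
    simp only [Finset.sum_empty, norm_zero]
    positivity

end Renorming

/-! ### Linearly independent representatives and the two cases -/

section Representation

/-- The sequence of unit vectors of the space of finitely supported sequences, with the seminorm
induced by a sequence `w`. -/
lemma exists_linearIndependent_norm_sum_eq {H : Type*} [SeminormedAddCommGroup H] [NormedSpace ℝ H]
    (w : ℕ → H) :
    ∃ (F : Type) (_ : SeminormedAddCommGroup F) (_ : NormedSpace ℝ F) (u : ℕ → F),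
      LinearIndependent ℝ u ∧ ∀ (n : ℕ) (a : ℕ → ℝ),
        ‖∑ j ∈ Finset.range n, a j • u j‖ = ‖∑ j ∈ Finset.range n, a j • w j‖ := by
  let T : (ℕ →₀ ℝ) →ₗ[ℝ] H := Finsupp.linearCombination ℝ w
  -- The pulled-back seminorm may vanish on nonzero vectors, while independence of the unit vectors
  -- is purely algebraic; so `w` may be linearly dependent.
  let i1 : SeminormedAddCommGroup (ℕ →₀ ℝ) := SeminormedAddCommGroup.induced _ _ T
  let i2 : NormedSpace ℝ (ℕ →₀ ℝ) := NormedSpace.induced ℝ (ℕ →₀ ℝ) H T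
  refine ⟨ℕ →₀ ℝ, i1, i2, fun n => Finsupp.single n 1, ?_, fun n a => ?_⟩
  · exact Finsupp.linearIndependent_single_one ℝ ℕ
  · have h : ∀ y : ℕ →₀ ℝ, ‖y‖ = ‖T y‖ := fun y => rfl
    rw [h, map_sum]
    simp [T]

lemma seqEquivalent_of_range {E F : Type*} [SeminormedAddCommGroup E] [NormedSpace ℝ E]
    [SeminormedAddCommGroup F] [NormedSpace ℝ F] {x : ℕ → E} {y : ℕ → F} {c C : ℝ} (hc : 0 < c)
    (h : ∀ (n : ℕ) (a : ℕ → ℝ),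
      c * ‖∑ i ∈ Finset.range n, a i • x i‖ ≤ ‖∑ i ∈ Finset.range n, a i • y i‖ ∧
        ‖∑ i ∈ Finset.range n, a i • y i‖ ≤ C * ‖∑ i ∈ Finset.range n, a i • x i‖) :
    SeqEquivalent x y := by
  refine ⟨c, max c C, hc, le_max_left _ _, fun n a => ?_⟩
  obtain ⟨b, rfl⟩ := exists_nat_extension a
  obtain ⟨h1, h2⟩ := h n b
  rw [← Fin.sum_univ_eq_sum_range (fun i => b i • x i),
    ← Fin.sum_univ_eq_sum_range (fun i => b i • y i)] at h1 h2
  exact ⟨h1, h2.trans (mul_le_mul_of_nonneg_right (le_max_right _ _) (norm_nonneg _))⟩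

variable {E : Type*} [NormedAddCommGroup E] [NormedSpace ℝ E]

lemma IsSpreading.isIntervalSuppressing {e : ℕ → E} (he : IsSpreading e)
    (h : UniformMeanLimit e 0) : IsIntervalSuppressing e := by
  intro n a p q _ hqn
  have h1 : Finset.Ico p q = (Finset.range n).filter (fun j => p ≤ j ∧ j < q) := by
    ext j
    simp only [Finset.mem_filter, Finset.mem_Ico, Finset.mem_range]
    omega
  rw [h1]
  exact he.norm_sum_filter_le h n a _

/-- The decomposition of a spreading sequence with unbounded basis constants. -/
theorem IsSpreading.exists_spreadingModel_of_not_hasBasisConstant [CompleteSpace E] {e : ℕ → E} (he : IsSpreading e)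
    (hC : ∀ C, ¬ HasBasisConstant e C) :
    ∃ v : E, v ≠ 0 ∧ WeaklyConverges e v ∧
      ∃ (F : Type) (_ : SeminormedAddCommGroup F) (_ : NormedSpace ℝ F) (u : ℕ → F),
        IsSpreadingModel CZero 2 u ∧ SeqEquivalent e u ∧
        ∀ (n : ℕ) (a : Fin n → ℝ),
          ‖∑ j, a j • u j‖ = max (|∑ j, a j| * ‖v‖) ‖∑ j, a j • (e j - v)‖ := by
  obtain ⟨v, hv0, hv⟩ := he.exists_uniformMeanLimit hC
  refine ⟨v, hv0, hv.weaklyConverges, ?_⟩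
  obtain ⟨F, i1, i2, u, hu, hnorm⟩ :=
    -- The supremum norm of `ℝ × E` produces the required maximum.
    exists_linearIndependent_norm_sum_eq (fun j => ((‖v‖ : ℝ), e j - v))
  have hmax : ∀ (n : ℕ) (a : ℕ → ℝ), ‖∑ j ∈ Finset.range n, a j • u j‖ =
      max (|∑ j ∈ Finset.range n, a j| * ‖v‖) ‖∑ j ∈ Finset.range n, a j • (e j - v)‖ := by
    intro n a
    rw [hnorm, Prod.norm_def, Prod.fst_sum, Prod.snd_sum]
    simp only [Prod.smul_mk, smul_eq_mul]
    rw [← Finset.sum_mul, Real.norm_eq_abs, abs_mul, abs_norm]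
  have hs := he.sub_uniformMeanLimit hv
  refine ⟨F, i1, i2, u, ?_, ?_, ?_⟩
  · exact isSpreadingModel_of_norm_eq_max (norm_nonneg v) hs (hs.isIntervalSuppressing hv.sub) hu
      hmax
  -- Both constants come from the triangle inequality for `e j = v + (e j - v)`; the upper one also
  -- uses the bound on `|∑ a j| * ‖v‖`.
  · refine seqEquivalent_of_range (c := 1 / 2) (C := 2) (by norm_num) fun n a => ?_
    rw [hmax]
    have h1 : ∑ j ∈ Finset.range n, a j • e j = (∑ j ∈ Finset.range n, a j) • v +
        ∑ j ∈ Finset.range n, a j • (e j - v) := by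
      simp only [smul_sub, Finset.sum_sub_distrib, ← Finset.sum_smul]
      abel
    have h2 := he.abs_sum_mul_norm_le hv n a
    have h3 := norm_add_le ((∑ j ∈ Finset.range n, a j) • v)
      (∑ j ∈ Finset.range n, a j • (e j - v))
    have h4 := norm_sub_le (∑ j ∈ Finset.range n, a j • e j) ((∑ j ∈ Finset.range n, a j) • v)
    rw [← h1, norm_smul, Real.norm_eq_abs] at h3
    nth_rewrite 1 [h1] at h4
    rw [add_sub_cancel_left, norm_smul, Real.norm_eq_abs] at h4
    have h5 := le_max_left (|∑ j ∈ Finset.range n, a j| * ‖v‖)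
      ‖∑ j ∈ Finset.range n, a j • (e j - v)‖
    have h6 := le_max_right (|∑ j ∈ Finset.range n, a j| * ‖v‖)
      ‖∑ j ∈ Finset.range n, a j • (e j - v)‖
    refine ⟨by linarith, max_le ?_ ?_⟩
    · linarith [norm_nonneg (∑ j ∈ Finset.range n, a j • e j)]
    · linarith
  · intro n a
    obtain ⟨b, rfl⟩ := exists_nat_extension a
    rw [Fin.sum_univ_eq_sum_range (fun j => b j • u j), Fin.sum_univ_eq_sum_range b,
      Fin.sum_univ_eq_sum_range (fun j => b j • (e j - v)), hmax]

/-- A spreading sequence with a finite basis constant is equivalent to a `2`-spreading model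
of `c₀`. -/
theorem IsSpreading.exists_spreadingModel_of_hasBasisConstant {e : ℕ → E} (he : IsSpreading e)
    {C : ℝ} (hC : HasBasisConstant e C) :
    ∃ (F : Type) (_ : SeminormedAddCommGroup F) (_ : NormedSpace ℝ F) (u : ℕ → F),
      IsSpreadingModel CZero 2 u ∧ SeqEquivalent e u := by
  obtain ⟨F, i1, i2, u, hu, hnorm⟩ := exists_linearIndependent_norm_sum_eq (intervalSums e)
  -- If all terms have norm zero, `C` may be negative.
  have hC' : HasBasisConstant e |C| := fun n a i hi =>
    (hC n a i hi).trans (mul_le_mul_of_nonneg_right (le_abs_self C) (norm_nonneg _))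
  refine ⟨F, i1, i2, u, ?_, ?_⟩
  · refine isSpreadingModel_of_norm_eq_max le_rfl (isSpreading_intervalSums he)
      (isIntervalSuppressing_intervalSums e) hu fun n a => ?_
    rw [hnorm, mul_zero, max_eq_right (norm_nonneg _)]
  · refine seqEquivalent_of_range (C := 2 * |C|) one_pos fun n a => ?_
    rw [hnorm, one_mul]
    exact ⟨norm_le_norm_sum_intervalSums e n a, hC'.norm_sum_intervalSums_le (abs_nonneg C) n a⟩

lemma IsSpreading.exists_spreadingModel [CompleteSpace E] {e : ℕ → E} (he : IsSpreading e) :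
    ∃ (F : Type) (_ : SeminormedAddCommGroup F) (_ : NormedSpace ℝ F) (u : ℕ → F),
      IsSpreadingModel CZero 2 u ∧ SeqEquivalent e u := by
  by_cases hC : ∃ C, HasBasisConstant e C
  · obtain ⟨C, hC⟩ := hC
    exact he.exists_spreadingModel_of_hasBasisConstant hC
  · obtain ⟨v, -, -, F, i1, i2, u, h1, h2, -⟩ :=
      he.exists_spreadingModel_of_not_hasBasisConstant (not_exists.1 hC)
    exact ⟨F, i1, i2, u, h1, h2⟩

/-- A nontrivial spreading sequence has no zero term, so a finite basis constant would make it
Schauder basic. -/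
lemma IsSingularSpreading.not_hasBasisConstant {e : ℕ → E} (h : IsSingularSpreading e) (C : ℝ) :
    ¬ HasBasisConstant e C := by
  obtain ⟨hs, ht, hb⟩ := h
  refine fun hC => hb (hC.isSchauderBasic fun n hn => ht ⟨hs, 1, fun _ => 1, ?_, ?_⟩)
  · exact fun h0 => one_ne_zero (congrFun h0 0)
  · have := hs.norm_eq 0 n
    simpa [hn] using this

end Representation

theorem mainTheorem3 :
    -- every spreading sequence is equivalent to a 2-spreading model of c₀
    (∀ (E : Type*) [SeminormedAddCommGroup E] [NormedSpace ℝ E] (e : ℕ → E), IsSpreading e →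
      ∃ (F : Type) (_ : SeminormedAddCommGroup F) (_ : NormedSpace ℝ F) (u : ℕ → F),
        IsSpreadingModel CZero 2 u ∧ SeqEquivalent e u) ∧
    -- every bimonotone Schauder basic spreading sequence is a 2-spreading model of c₀
    (∀ (E : Type*) [NormedAddCommGroup E] [NormedSpace ℝ E] [CompleteSpace E] (e : ℕ → E),
      IsSpreading e → IsBimonotoneSchauderBasic e → IsSpreadingModel CZero 2 e) ∧
    -- singular spreading sequences, through their natural decomposition e n = (e n - v) + v
    (∀ (E : Type*) [NormedAddCommGroup E] [NormedSpace ℝ E] [CompleteSpace E] (e : ℕ → E),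
      IsSingularSpreading e →
      ∃ v : E, v ≠ 0 ∧ WeaklyConverges e v ∧
        ∃ (F : Type) (_ : SeminormedAddCommGroup F) (_ : NormedSpace ℝ F) (u : ℕ → F),
          IsSpreadingModel CZero 2 u ∧ SeqEquivalent e u ∧
          ∀ (n : ℕ) (a : Fin n → ℝ),
            ‖∑ j, a j • u j‖ = max (|∑ j, a j| * ‖v‖) ‖∑ j, a j • (e j - v)‖) := by
  refine ⟨?_, ?_, ?_⟩
  · intro E _ _ e he
    -- The limit of means needs a complete normed space; the isometry into the completion preserves
    -- the norms of all combinations.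
    let ι : E →ₗᵢ[ℝ] UniformSpace.Completion E := UniformSpace.Completion.toComplₗᵢ
    have hnorm : ∀ (n : ℕ) (a : Fin n → ℝ) (k : Fin n → ℕ),
        ‖∑ j, a j • ι (e (k j))‖ = ‖∑ j, a j • e (k j)‖ := by
      intro n a k
      rw [← ι.norm_map, map_sum]
      simp only [map_smul]
    have he' : IsSpreading fun n => ι (e n) := by
      intro n a k hk
      rw [hnorm n a (fun j => j), hnorm n a k]
      exact he n a k hk
    obtain ⟨F, i1, i2, u, h1, c, C, hc, hcC, h2⟩ := he'.exists_spreadingModel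
    refine ⟨F, i1, i2, u, h1, c, C, hc, hcC, fun n a => ?_⟩
    have h3 := h2 n a
    rwa [hnorm n a (fun j => j)] at h3
  · intro E _ _ _ e he hb
    have hS : IsSchauderBasic e := by
      obtain ⟨b, hb, -⟩ := hb
      exact ⟨b, hb⟩
    refine isSpreadingModel_of_norm_eq_max le_rfl he hb.isIntervalSuppressing
      hS.linearIndependent fun n a => ?_
    rw [mul_zero, max_eq_right (norm_nonneg _)]
  · intro E _ _ _ e he
    exact he.1.exists_spreadingModel_of_not_hasBasisConstant he.not_hasBasisConstant
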